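/- Let $k\ge 1$ be an integer and let $P_1(X)=X,P_2,\dots,P_k\in\mathbb{Q}[X]$ have degrees $1=d_1\le d_2\le\cdots\le d_k$. Let $\mathscr{C}=\{(X,P_2(X),\dots,P_k(X)):X\in\mathbb{R}\}\subseteq\mathbb{R}^k$, and assume that $\mathscr{C}$ is non-degenerate, i.e. that $1,P_1,\dots,P_k$ are linearly independent over $\mathbb{Q}$. Write $\Vert\alpha\Vert$ for the distance of $\alpha\in\mathbb{R}$ to the nearest integer. For an integer $n\ge1$ and real $\mu>0$, let $\mathscr{H}^n_\mu$ be the set of $(\zeta_1,\dots,\zeta_n)\in\mathbb{R}^n$ such that for every $\epsilon>0$ the inequality $\max_{1\le j\le n}\Vert q\zeta_j\Vert\le q^{-\mu+\epsilon}$ has infinitely many positive integer solutions $q$ (for $n=1$ this is a subset of $\mathbb{R}$). Let $\Pi_1:\mathbb{R}^k\to\mathbb{R}$ be the projection to the first coordinate, and for $\zeta\in\mathbb{R}$ let $\lambda_1(\zeta)\in[0,\infty]$ be the supremum of the real numbers $\nu$ such that $\Vert q\zeta\Vert\le q^{-\nu}$ has infinitely many positive integer solutions $q$. Then for every real $\lambda>d_k-k+1$,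 $$\Pi_1(\mathscr{C}\cap\mathscr{H}^k_\lambda)=\mathscr{H}^1_{d_k\lambda+d_k-1}=\{\zeta\in\mathbb{R}:\lambda_1(\zeta)\ge d_k\lambda+d_k-1\},$$ and the Hausdorff dimension of $\mathscr{C}\cap\mathscr{H}^k_\lambda$ is $$\dim(\mathscr{C}\cap\mathscr{H}^k_\lambda)=\frac{2}{d_k(\lambda+1)}.$$ -/

import Mathlib

open Polynomial

namespace CurveApprox

/-- The distance of a real number to the nearest integer. -/
noncomputable def distInt (x : ℝ) : ℝ := |x - round x|

/-- The set of points `ζ` of `ℝᵏ` such that, for every `ε > 0`, the estimate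
`max_j ‖q ζ_j‖ ≤ q ^ (-lam + ε)` has infinitely many positive integer solutions `q`. -/
def H (k : ℕ) (lam : ℝ) : Set (EuclideanSpace ℝ (Fin k)) :=
  {ζ | ∀ ε : ℝ, 0 < ε →
    {q : ℕ | 0 < q ∧ ∀ j : Fin k, distInt ((q : ℝ) * ζ j) ≤ (q : ℝ) ^ (-lam + ε)}.Infinite}

/-- The set `H 1 lam`, seen as a set of real numbers through the identification of `ℝ¹`
with `ℝ`. -/
def H1 (lam : ℝ) : Set ℝ := {ζ | WithLp.toLp 2 (fun _ : Fin 1 => ζ) ∈ H 1 lam}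

/-- The supremum (possibly `+∞`) of the real numbers `ν` for which `‖q ζ‖ ≤ q ^ (-ν)` has
infinitely many positive integer solutions `q`. -/
noncomputable def lambda1 (ζ : ℝ) : EReal :=
  sSup {x : EReal | ∃ ν : ℝ, x = (ν : EReal) ∧
    {q : ℕ | 0 < q ∧ distInt ((q : ℝ) * ζ) ≤ (q : ℝ) ^ (-ν)}.Infinite}

/-- The curve `{(P₁(t), …, P_k(t)) : t ∈ ℝ}` in `ℝᵏ`. -/
noncomputable def curve {k : ℕ} (P : Fin k → ℚ[X]) : Set (EuclideanSpace ℝ (Fin k)) :=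
  Set.range fun t : ℝ => WithLp.toLp 2 fun j : Fin k => aeval t (P j)

/-- The curve is non-degenerate: the polynomials `1, P₁, …, P_k` are linearly independent
over `ℚ`. -/
def NonDegenerate {k : ℕ} (P : Fin k → ℚ[X]) : Prop :=
  LinearIndependent ℚ (Fin.cons 1 P : Fin (k + 1) → ℚ[X])

end CurveApprox

/-!
The theorem has an arithmetic part, which turns simultaneous approximation on the curve into
approximation of the parameter `t` alone, and a metric part, the Jarník–Besicovitch theorem.

Arithmetic part. If `p / q` is very close to `t` then, for a fixed common denominator `N` of the
coefficients, `N q ^ d` is a common denominator of all the `P_j (p / q)`, hence a good denominator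
for all the `P_j t` (`mem_H_of_mem_H1`). Conversely, let `Q` be a good denominator for all the
`P_j t`, and let `p / q` be the reduced form of the fraction of denominator `Q` closest to `t`.
The claim is that `q ^ d` divides `Q` up to a bounded factor, so that `Q` is at least of order
`q ^ d` and `p / q` is an excellent approximation (`mem_H1_of_mem_H`). This is proved by induction
along the set of degrees of the elements of the span `V` of `1, P₁, …, P_k`
(`eventually_den_pow_dvd`). If `q ^ a` divides `c Q` and `F ∈ V` has integral coefficients and
degree `b > a`, the number `c Q F(p / q)` is close to an integer and has a denominator dividing
`q ^ (b - a) ≤ Q ^ (b - a)`. As soon as `b - a < lam` it is therefore an integer; since `q` is prime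
to the numerator `p`, this forces `q ^ b` to divide `Q` up to a bounded factor. As `V` has dimension
`k + 1`, exactly `k + 1` of the degrees `0, …, d` occur in `V`, so that consecutive ones differ by at
most `d - k + 1` (`exists_natDegree_lt`), which is less than `lam`.

Metric part. With `μ = d lam + d - 1 > 1`, the dimension of `H1 μ` is `2 / (1 + μ)` (`dimH_H1`).
The upper bound is the covering of `H1 μ` by balls around fractions. For the lower bound, a Cantor
set is built inside `H1 μ`, each interval of a stage containing about `l N ^ 2` intervals of the next
one, around fractions of denominators comparable with a huge `N`
(`eventually_exists_finset_rat`, `CantorStage.exists_next`). Instead of measuring this set, one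
parametrizes it by `[0, 1)` with an inverse which is Hölder continuous of any exponent less than
`2 / (1 + μ)`, and uses the behaviour of the dimension under Hölder maps
(`mul_dimH_le_dimH_image`). Finally, the first projection and the parametrization of the curve
preserve the dimension, one being Lipschitz and the other continuously differentiable.
-/

namespace CurveApprox

open Filter Topology Set

/-! ### Distance to the nearest integer -/

lemma distInt_nonneg (x : ℝ) : 0 ≤ distInt x := abs_nonneg _

lemma distInt_le_abs_sub (x : ℝ) (n : ℤ) : distInt x ≤ |x - n| := round_le x n

lemma distInt_add_le (x y : ℝ) : distInt (x + y) ≤ distInt x + distInt y := by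
  refine (distInt_le_abs_sub _ (round x + round y)).trans ?_
  have h : x + y - ((round x + round y : ℤ) : ℝ) = (x - round x) + (y - round y) := by
    push_cast; ring
  rw [h]
  exact abs_add_le _ _

lemma distInt_int_mul_le (n : ℤ) (x : ℝ) : distInt (n * x) ≤ |(n : ℝ)| * distInt x := by
  refine (distInt_le_abs_sub _ (n * round x)).trans ?_
  rw [distInt, ← abs_mul]
  apply le_of_eq
  congr 1
  push_cast
  ring

lemma distInt_le_add_abs_sub (x y : ℝ) : distInt x ≤ distInt y + |x - y| := by
  refine (distInt_le_abs_sub x (round y)).trans ?_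
  have h : x - round y = (y - round y) + (x - y) := by ring
  rw [h]
  exact abs_add_le _ _

lemma mem_H1_iff {lam ζ : ℝ} : ζ ∈ H1 lam ↔ ∀ ε : ℝ, 0 < ε →
    {q : ℕ | 0 < q ∧ distInt ((q : ℝ) * ζ) ≤ (q : ℝ) ^ (-lam + ε)}.Infinite := by
  simp [H1, H]

theorem H1_eq_setOf_le_lambda1 (μ : ℝ) : H1 μ = {ζ : ℝ | (μ : EReal) ≤ lambda1 ζ} := by
  ext ζ
  rw [mem_H1_iff, mem_ofPred_eq]
  constructor
  · intro h
    by_contra! hlt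
    obtain ⟨ν, h1, h2⟩ := EReal.lt_iff_exists_real_btwn.1 hlt
    have h2' : ν < μ := by exact_mod_cast h2
    refine absurd (le_sSup ?_) (not_le.2 h1)
    refine ⟨ν, rfl, ?_⟩
    have := h (μ - ν) (by linarith)
    rwa [show -μ + (μ - ν) = -ν by ring] at this
  · intro h ε hε
    have hlt : ((μ - ε : ℝ) : EReal) < lambda1 ζ :=
      lt_of_lt_of_le (by exact_mod_cast (by linarith : μ - ε < μ)) h
    obtain ⟨_, ⟨ν, rfl, hν⟩, hlt'⟩ := lt_sSup_iff.1 hlt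
    have hlt'' : μ - ε < ν := by exact_mod_cast hlt'
    refine hν.mono ?_
    rintro q ⟨hq, hle⟩
    refine ⟨hq, hle.trans ?_⟩
    exact Real.rpow_le_rpow_of_exponent_le (by exact_mod_cast hq) (by linarith)

/-! ### Integral polynomials at rational points -/

/-- Multiplying `F (p / q)` by the `b`-th power of the denominator gives an integer, whose class
modulo `q` only depends on the coefficient of degree `b`. -/
lemma exists_int_pow_mul_aeval_div (F : ℤ[X]) {b : ℕ} (hb : F.natDegree ≤ b) (p : ℤ) {q : ℕ}
    (hq : 0 < q) : ∃ s : ℤ,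
      (q : ℝ) ^ b * aeval ((p : ℝ) / q) F = ((F.coeff b * p ^ b + q * s : ℤ) : ℝ) := by
  have hq' : (q : ℝ) ≠ 0 := by positivity
  refine ⟨∑ i ∈ Finset.range b, F.coeff i * p ^ i * (q : ℤ) ^ (b - i - 1), ?_⟩
  rw [aeval_eq_sum_range' (Nat.lt_succ_of_le hb), Finset.sum_range_succ, mul_add, add_comm,
    Finset.mul_sum]
  push_cast
  rw [Finset.mul_sum]
  congr 1
  · simp only [zsmul_eq_mul, div_pow]
    field_simp
  · refine Finset.sum_congr rfl fun i hi => ?_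
    have hi' := Finset.mem_range.1 hi
    obtain ⟨n, rfl⟩ : ∃ n, b = i + 1 + n := ⟨b - i - 1, by omega⟩
    rw [show i + 1 + n - i - 1 = n by omega, zsmul_eq_mul, pow_add, pow_add, div_pow]
    field_simp

/-- Near a point, a polynomial function satisfies a Lipschitz estimate. -/
lemma exists_abs_aeval_sub_le {R : Type*} [CommRing R] [Algebra R ℝ] (F : R[X]) (t : ℝ) :
    ∃ C : ℝ, 0 ≤ C ∧ ∀ x : ℝ, |t - x| ≤ 1 → |aeval t F - aeval x F| ≤ C * |t - x| := by
  obtain ⟨C, hC⟩ := (isCompact_Icc (a := t - 1) (b := t + 1)).exists_bound_of_continuousOn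
    (f := fun x : ℝ => aeval x (derivative F)) (Polynomial.continuous_aeval _).continuousOn
  have h0 : 0 ≤ C := (norm_nonneg _).trans (hC t (by constructor <;> linarith))
  refine ⟨C, h0, fun x hx => ?_⟩
  have hx' := abs_le.1 hx
  refine (convex_Icc (t - 1) (t + 1)).norm_image_sub_le_of_norm_deriv_le (𝕜 := ℝ)
    (f := fun x : ℝ => aeval x F) (fun y _ => (Polynomial.differentiable_aeval F).differentiableAt)
    (fun y hy => ?_) ?_ ?_
  · rw [Polynomial.deriv_aeval]; exact hC y hy
  · constructor <;> linarith
  · constructor <;> linarith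

/-- As `p` is prime to `q`, the common divisors of `q` and `A p ^ b + q s` divide `A`. Hence the
power of `q` dividing the product divides `m`, up to a power of `A`. -/
lemma pow_dvd_mul_pow_of_dvd_mul {q p A s m : ℤ} {b n : ℕ} (hpq : IsCoprime p q)
    (h : q ^ n ∣ m * (A * p ^ b + q * s)) : q ^ n ∣ m * A ^ n := by
  -- modulo `q`, the factor `x = A p ^ b + q s` generates an ideal containing `A`
  obtain ⟨u, v, huv⟩ := hpq.pow_left (m := b)
  set x := A * p ^ b + q * s with hx
  have hA : A = u * x + q * (A * v - u * s) := by
    rw [hx]; linear_combination -A * huv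
  have key : ∀ i ≤ n, q ^ n ∣ m * A ^ i * q ^ (n - i) := by
    intro i
    induction i with
    | zero => intro _; simp
    | succ i ih =>
      intro hi
      obtain ⟨c, hc⟩ := ih (by omega)
      obtain ⟨e, he⟩ := h
      refine ⟨u * (e * A ^ i * q ^ (n - (i + 1))) + c * (A * v - u * s), ?_⟩
      have h2 : q ^ (n - i) = q ^ (n - (i + 1)) * q := by
        rw [← pow_succ]; congr 1; omega
      calc m * A ^ (i + 1) * q ^ (n - (i + 1))
          = m * A ^ i * q ^ (n - (i + 1)) * A := by ring
        _ = m * A ^ i * q ^ (n - (i + 1)) * (u * x + q * (A * v - u * s)) := by rw [← hA]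
        _ = u * (m * x) * A ^ i * q ^ (n - (i + 1))
            + m * A ^ i * (q ^ (n - (i + 1)) * q) * (A * v - u * s) := by ring
        _ = _ := by rw [he, ← h2, hc]; ring
  simpa using key n le_rfl

/-- A rational number of denominator dividing `N` and closer than `1 / N` to the integers is an
integer. -/
lemma dvd_of_distInt_div_lt {N x : ℤ} (hN : 0 < N) (h : distInt ((x : ℝ) / N) < 1 / N) :
    N ∣ x := by
  have hN' : (0 : ℝ) < N := by exact_mod_cast hN
  set z := round ((x : ℝ) / N)
  have h1 : |(x : ℝ) / N - z| < 1 / N := h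
  have h2 : |((x - z * N : ℤ) : ℝ)| < 1 := by
    have : ((x - z * N : ℤ) : ℝ) = ((x : ℝ) / N - z) * N := by
      push_cast; field_simp
    rw [this, abs_mul, abs_of_pos hN']
    calc _ < 1 / (N : ℝ) * N := by gcongr
      _ = 1 := by field_simp
  have h3 : x - z * N = 0 := Int.abs_lt_one_iff.1 (by exact_mod_cast h2)
  exact ⟨z, by linarith⟩

/-- If some positive multiple of `t` is an integer, then so are infinitely many: rational numbers are
approximable to every order. -/
lemma infinite_of_distInt_eq_zero {t ν : ℝ} {q : ℕ} (hq : 0 < q) (h : distInt (q * t) = 0) :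
    {q : ℕ | 0 < q ∧ distInt ((q : ℝ) * t) ≤ (q : ℝ) ^ ν}.Infinite := by
  have hinj : Function.Injective fun n : ℕ => (n + 1) * q := fun a b hab => by
    have := Nat.eq_of_mul_eq_mul_right hq hab
    omega
  refine (infinite_range_of_injective hinj).mono ?_
  rintro _ ⟨n, rfl⟩
  refine ⟨by positivity, ?_⟩
  have h1 := distInt_int_mul_le (n + 1 : ℕ) (q * t)
  rw [h, mul_zero] at h1
  refine le_trans (le_of_eq ?_) (h1.trans (by positivity))
  congr 1
  push_cast
  ring

/-! ### From approximations of the parameter to approximations of the point -/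

lemma exists_intPoly_map_eq (R : ℚ[X]) :
    ∃ (D : ℕ) (F : ℤ[X]), 0 < D ∧ ∀ x : ℝ, aeval x F = D * aeval x R := by
  obtain ⟨b, hb, h⟩ := IsLocalization.integerNormalization_spec (nonZeroDivisors ℤ) R
  have hb0 : b ≠ 0 := nonZeroDivisors.ne_zero hb
  set F := IsLocalization.integerNormalization (nonZeroDivisors ℤ) R
  have h1 : ∀ x : ℝ, aeval x F = b * aeval x R := fun x => by
    rw [← aeval_map_algebraMap ℚ x F, h, map_zsmul, zsmul_eq_mul]
  refine ⟨b.natAbs, C b.sign * F, Int.natAbs_pos.2 hb0, fun x => ?_⟩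
  rw [map_mul, h1, aeval_C, ← mul_assoc]
  congr 1
  simp only [algebraMap_int_eq, eq_intCast]
  rw [← Int.cast_mul, Int.sign_mul_self_eq_abs]
  simp

lemma natDegree_eq_of_aeval_eq {F : ℤ[X]} {R : ℚ[X]} {D : ℝ} (hD : D ≠ 0)
    (h : ∀ x : ℝ, aeval x F = D * aeval x R) : F.natDegree = R.natDegree := by
  have h1 : F.map (algebraMap ℤ ℝ) = C D * R.map (algebraMap ℚ ℝ) := by
    refine Polynomial.funext fun x => ?_
    rw [eval_mul, eval_C, eval_map_algebraMap, eval_map_algebraMap, h]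
  have h2 := congrArg natDegree h1
  rwa [natDegree_C_mul hD, natDegree_map_eq_of_injective (algebraMap ℚ ℝ).injective,
    natDegree_map_eq_of_injective (RingHom.injective_int (algebraMap ℤ ℝ))] at h2

lemma tendsto_natCast_rpow_atTop_zero {x : ℝ} (hx : x < 0) :
    Tendsto (fun q : ℕ => (q : ℝ) ^ x) atTop (𝓝 0) := by
  have := (tendsto_rpow_neg_atTop (y := -x) (by linarith)).comp tendsto_natCast_atTop_atTop
  simpa [Function.comp_def] using this

lemma eventually_mul_rpow_lt (c : ℝ) {x η : ℝ} (hx : x < 0) (hη : 0 < η) :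
    ∀ᶠ q : ℕ in atTop, c * (q : ℝ) ^ x < η := by
  have h := (tendsto_natCast_rpow_atTop_zero hx).const_mul c
  rw [mul_zero] at h
  exact h.eventually_lt_const hη

/-- A fraction `p / q` close to `t` yields the simultaneous denominator `N q ^ d`, where `N` clears the
denominators of the coefficients of the `P_j`. -/
theorem mem_H_of_mem_H1 {k : ℕ} (P : Fin k → ℚ[X]) {d : ℕ} (hd : 0 < d)
    (hdeg : ∀ j, (P j).natDegree ≤ d) {lam t : ℝ} (hlam : 0 < lam)
    (ht : t ∈ H1 ((d : ℝ) * lam + (d : ℝ) - 1)) :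
    WithLp.toLp 2 (fun j => aeval t (P j)) ∈ H k lam := by
  rw [mem_H1_iff] at ht
  choose D F hD hF using fun j => exists_intPoly_map_eq (P j)
  set N : ℕ := ∏ j, D j with hN
  have hN0 : 0 < N := Finset.prod_pos fun j _ => hD j
  have hN0' : (0 : ℝ) < N := by exact_mod_cast hN0
  have hd' : (1 : ℝ) ≤ d := by exact_mod_cast hd
  intro ε hε
  set δ : ℝ := min (d * ε / 2) (d * lam) with hδ
  have hδ0 : 0 < δ := by positivity
  have hδ1 : δ < d * ε := lt_of_le_of_lt (min_le_left _ _) (by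
    have : 0 < (d : ℝ) * ε := by positivity
    linarith)
  have hδ2 : δ ≤ d * lam := min_le_right _ _
  have hinf := Nat.frequently_atTop_iff_infinite.2 (ht δ hδ0)
  have hev : ∀ j, ∀ᶠ q : ℕ in atTop,
      distInt ((q : ℝ) * t) ≤ (q : ℝ) ^ (-(d * lam + d - 1) + δ) →
        distInt (((N * q ^ d : ℕ) : ℝ) * aeval t (P j)) ≤ ((N * q ^ d : ℕ) : ℝ) ^ (-lam + ε) := by
    intro j
    obtain ⟨K, hK0, hK⟩ := exists_abs_aeval_sub_le (P j) t
    have hsm := eventually_mul_rpow_lt (N * K) (x := δ - d * ε) (η := (N : ℝ) ^ (-lam + ε))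
      (by linarith) (by positivity)
    filter_upwards [hsm, eventually_gt_atTop 0] with q hq hq0 happ
    have hq0' : (0 : ℝ) < q := by exact_mod_cast hq0
    have hq1 : (1 : ℝ) ≤ q := by exact_mod_cast hq0
    set p := round ((q : ℝ) * t)
    have hclose : |t - p / q| ≤ (q : ℝ) ^ (-(d * lam + d) + δ) := by
      have h1 : t - p / q = (q * t - p) / q := by field_simp
      rw [h1, abs_div, abs_of_pos hq0', div_le_iff₀ hq0', ← Real.rpow_add_one hq0'.ne']
      rw [show -(d * lam + d) + δ + 1 = -(d * lam + d - 1) + δ by ring]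
      exact happ
    have hle1 : |t - p / q| ≤ 1 :=
      hclose.trans (Real.rpow_le_one_of_one_le_of_nonpos hq1 (by linarith))
    obtain ⟨s, hs⟩ := exists_int_pow_mul_aeval_div (F j)
      ((natDegree_eq_of_aeval_eq (by exact_mod_cast (hD j).ne') (hF j)).le.trans (hdeg j)) p hq0
    obtain ⟨M, hM⟩ : D j ∣ N := Finset.dvd_prod_of_mem _ (Finset.mem_univ j)
    -- `N q ^ d` is a common denominator of the values of the polynomials at `p / q`
    have hint : ∃ z : ℤ, ((N * q ^ d : ℕ) : ℝ) * aeval ((p : ℝ) / q) (P j) = z := by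
      refine ⟨M * ((F j).coeff d * p ^ d + q * s), ?_⟩
      rw [Int.cast_mul, ← hs, hF, hM]
      push_cast
      ring
    obtain ⟨z, hz⟩ := hint
    refine (distInt_le_abs_sub _ z).trans ?_
    rw [← hz, ← mul_sub, abs_mul, abs_of_nonneg (by positivity)]
    calc ((N * q ^ d : ℕ) : ℝ) * |aeval t (P j) - aeval ((p : ℝ) / q) (P j)|
        ≤ ((N * q ^ d : ℕ) : ℝ) * (K * (q : ℝ) ^ (-(d * lam + d) + δ)) := by
          gcongr
          exact (hK _ hle1).trans (by gcongr)
      _ = (N * K * (q : ℝ) ^ (δ - d * ε)) * (q : ℝ) ^ (d * (-lam + ε)) := by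
          push_cast
          rw [mul_assoc (N * K : ℝ), ← Real.rpow_add hq0', ← Real.rpow_natCast]
          rw [show δ - d * ε + d * (-lam + ε) = d + (-(d * lam + d) + δ) by ring,
            Real.rpow_add hq0' d]
          ring
      _ ≤ (N : ℝ) ^ (-lam + ε) * (q : ℝ) ^ (d * (-lam + ε)) := by gcongr
      _ = _ := by
          push_cast
          rw [Real.mul_rpow hN0'.le (by positivity), ← Real.rpow_natCast, ← Real.rpow_mul hq0'.le]
  have hinf' := hinf.and_eventually ((eventually_all.2 hev).and (eventually_gt_atTop 0))
  rw [Nat.frequently_atTop_iff_infinite] at hinf'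
  have hinj : Set.InjOn (fun q : ℕ => N * q ^ d) univ := by
    intro a _ b _ hab
    exact Nat.pow_left_injective hd.ne' (Nat.eq_of_mul_eq_mul_left hN0 hab)
  refine (hinf'.image (hinj.mono (subset_univ _))).mono ?_
  rintro _ ⟨q, ⟨⟨_, hq⟩, hq', hq0⟩, rfl⟩
  exact ⟨by positivity, fun j => hq' j hq⟩

/-! ### From approximations of the point to approximations of the parameter -/

/-- Every polynomial in the rational span of `1, P₁, …, P_k` has a positive integral multiple which
is, up to a constant, as well approximated at `t` as the `P_j` are. -/
lemma exists_distInt_le_of_mem_span {k : ℕ} (P : Fin k → ℚ[X]) (t : ℝ) {R : ℚ[X]}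
    (hR : R ∈ Submodule.span ℚ (range (Fin.cons 1 P : Fin (k + 1) → ℚ[X]))) :
    ∃ (N : ℕ) (C : ℝ), 0 < N ∧ 0 ≤ C ∧ ∀ (Q : ℕ) (δ : ℝ), 0 ≤ δ →
      (∀ j, distInt ((Q : ℝ) * aeval t (P j)) ≤ δ) →
        distInt ((Q : ℝ) * (N * aeval t R)) ≤ C * δ := by
  induction hR using Submodule.span_induction with
  | mem x hx =>
    obtain ⟨i, rfl⟩ := hx
    refine ⟨1, 1, one_pos, zero_le_one, fun Q δ hδ h => ?_⟩
    refine Fin.cases ?_ (fun j => ?_) i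
    · have h1 := distInt_le_abs_sub (Q : ℝ) (Q : ℤ)
      simp only [Int.cast_natCast, sub_self, abs_zero] at h1
      simpa using h1.trans hδ
    · simpa using h j
  | zero =>
    refine ⟨1, 0, one_pos, le_rfl, fun Q δ hδ h => ?_⟩
    simpa using distInt_le_abs_sub 0 0
  | add x y _ _ hx hy =>
    obtain ⟨N₁, C₁, hN₁, hC₁, h₁⟩ := hx
    obtain ⟨N₂, C₂, hN₂, hC₂, h₂⟩ := hy
    refine ⟨N₁ * N₂, N₂ * C₁ + N₁ * C₂, by positivity, by positivity, fun Q δ hδ h => ?_⟩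
    have e : (Q : ℝ) * (((N₁ * N₂ : ℕ) : ℝ) * aeval t (x + y))
        = ((N₂ : ℤ) : ℝ) * (Q * (N₁ * aeval t x)) + ((N₁ : ℤ) : ℝ) * (Q * (N₂ * aeval t y)) := by
      rw [map_add]; push_cast; ring
    rw [e]
    refine (distInt_add_le _ _).trans ?_
    have a₁ := distInt_int_mul_le N₂ (Q * (N₁ * aeval t x))
    have a₂ := distInt_int_mul_le N₁ (Q * (N₂ * aeval t y))
    simp only [Int.cast_natCast, Nat.abs_cast] at a₁ a₂ ⊢
    calc _ ≤ (N₂ : ℝ) * (C₁ * δ) + N₁ * (C₂ * δ) := by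
          refine add_le_add (a₁.trans ?_) (a₂.trans ?_)
          · gcongr; exact h₁ Q δ hδ h
          · gcongr; exact h₂ Q δ hδ h
      _ = _ := by ring
  | smul c x _ hx =>
    obtain ⟨N, C, hN, hC, h₁⟩ := hx
    refine ⟨N * c.den, |(c.num : ℝ)| * C, Nat.mul_pos hN c.den_pos, by positivity,
      fun Q δ hδ h => ?_⟩
    have hc : (c : ℝ) * c.den = c.num := by exact_mod_cast Rat.mul_den_eq_num c
    have e : (Q : ℝ) * (((N * c.den : ℕ) : ℝ) * aeval t (c • x))
        = (c.num : ℝ) * (Q * (N * aeval t x)) := by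
      rw [map_smul, Rat.smul_def, ← hc]; push_cast; ring
    rw [e]
    refine (distInt_int_mul_le _ _).trans ?_
    rw [mul_assoc]
    gcongr
    exact h₁ Q δ hδ h

/-- A space of polynomials has at most as many dimensions as its nonzero elements have degrees. -/
lemma finrank_le_card_of_natDegree_mem (V : Submodule ℚ ℚ[X]) (T : Finset ℕ)
    (hT : ∀ R ∈ V, R ≠ 0 → R.natDegree ∈ T) : Module.finrank ℚ V ≤ T.card := by
  let f : V →ₗ[ℚ] (T → ℚ) := LinearMap.pi fun i => (lcoeff ℚ (i : ℕ)).comp V.subtype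
  have hf : Function.Injective f := by
    rw [← LinearMap.ker_eq_bot, LinearMap.ker_eq_bot']
    rintro ⟨R, hR⟩ h0
    by_contra hne
    have hR0 : R ≠ 0 := fun h => hne (by simp [h])
    have := congrFun h0 ⟨R.natDegree, hT R hR hR0⟩
    exact hR0 (leadingCoeff_eq_zero.1 this)
  simpa using LinearMap.finrank_le_finrank_of_injective hf

lemma finrank_span_of_nonDegenerate {k : ℕ} {P : Fin k → ℚ[X]} (hnd : NonDegenerate P) :
    Module.finrank ℚ (Submodule.span ℚ (range (Fin.cons 1 P : Fin (k + 1) → ℚ[X]))) = k + 1 := by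
  rw [finrank_span_eq_card hnd, Fintype.card_fin]

lemma natDegree_le_of_mem_span {k : ℕ} {P : Fin k → ℚ[X]} {d : ℕ}
    (hdeg : ∀ j, (P j).natDegree ≤ d) {R : ℚ[X]}
    (hR : R ∈ Submodule.span ℚ (range (Fin.cons 1 P : Fin (k + 1) → ℚ[X]))) :
    R.natDegree ≤ d := by
  have hle : Submodule.span ℚ (range (Fin.cons 1 P : Fin (k + 1) → ℚ[X])) ≤ degreeLE ℚ d := by
    rw [Submodule.span_le]
    rintro _ ⟨i, rfl⟩
    refine Fin.cases ?_ (fun j => ?_) i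
    · exact mem_degreeLE.2 (by simp)
    · exact mem_degreeLE.2 (degree_le_of_natDegree_le (by simpa using hdeg j))
  exact natDegree_le_of_degree_le (mem_degreeLE.1 (hle hR))

lemma le_of_nonDegenerate {k : ℕ} {P : Fin k → ℚ[X]} (hnd : NonDegenerate P) {d : ℕ}
    (hdeg : ∀ j, (P j).natDegree ≤ d) : k ≤ d := by
  have h := finrank_le_card_of_natDegree_mem _ (Finset.range (d + 1)) fun R hR _ =>
    Finset.mem_range.2 (Nat.lt_succ_of_le (natDegree_le_of_mem_span hdeg hR))
  rw [finrank_span_of_nonDegenerate hnd, Finset.card_range] at h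
  omega

/-- Below each positive degree occurring in a `(k + 1)`-dimensional space of polynomials of degree
at most `d` containing `1`, there is another one at distance at most `d - k + 1`. -/
lemma exists_natDegree_lt (V : Submodule ℚ ℚ[X]) {k d : ℕ} (hV : Module.finrank ℚ V = k + 1)
    (h1 : (1 : ℚ[X]) ∈ V) (hd : ∀ R ∈ V, R.natDegree ≤ d) {b : ℕ} (hb : 0 < b) (hbd : b ≤ d) :
    ∃ R ∈ V, R ≠ 0 ∧ R.natDegree < b ∧ b + k ≤ R.natDegree + d + 1 := by
  by_cases hbk : b + k ≤ d + 1
  · exact ⟨1, h1, one_ne_zero, by simpa using hb, by simpa using hbk⟩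
  · by_contra! hcon
    have hle := finrank_le_card_of_natDegree_mem V
      (Finset.range (b + k - d - 1) ∪ Finset.Icc b d) fun R hR hR0 => by
        have h2 := hcon R hR hR0
        have h3 := hd R hR
        rw [Finset.mem_union, Finset.mem_range, Finset.mem_Icc]
        by_cases h4 : R.natDegree < b
        · have := h2 h4
          omega
        · omega
    have hc := hle.trans (Finset.card_union_le _ _)
    rw [hV, Finset.card_range, Nat.card_Icc] at hc
    omega

lemma exists_intPoly_of_mem_span {k : ℕ} (P : Fin k → ℚ[X]) (t : ℝ) {R : ℚ[X]} (hR0 : R ≠ 0)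
    (hR : R ∈ Submodule.span ℚ (range (Fin.cons 1 P : Fin (k + 1) → ℚ[X]))) :
    ∃ (F : ℤ[X]) (C : ℝ), F ≠ 0 ∧ F.natDegree = R.natDegree ∧ 0 ≤ C ∧ ∀ (Q : ℕ) (δ : ℝ), 0 ≤ δ →
      (∀ j, distInt ((Q : ℝ) * aeval t (P j)) ≤ δ) →
        distInt ((Q : ℝ) * aeval t F) ≤ C * δ := by
  obtain ⟨N, C, hN, hC, h⟩ := exists_distInt_le_of_mem_span P t hR
  obtain ⟨D, F, hD, hF⟩ := exists_intPoly_map_eq R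
  have hN' : (N : ℝ) ≠ 0 := by positivity
  have hD' : (D : ℝ) ≠ 0 := by positivity
  have hval : ∀ x : ℝ, aeval x ((N : ℤ[X]) * F) = (N * D : ℝ) * aeval x R := fun x => by
    rw [map_mul, hF, map_natCast, mul_assoc]
  refine ⟨(N : ℤ[X]) * F, D * C, ?_, natDegree_eq_of_aeval_eq (mul_ne_zero hN' hD') hval,
    by positivity, fun Q δ hδ hj => ?_⟩
  · intro h0
    apply hR0
    refine Polynomial.map_injective _ (algebraMap ℚ ℝ).injective (Polynomial.funext fun x => ?_)
    have := hval x
    rw [h0, map_zero] at this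
    rw [eval_map_algebraMap, Polynomial.map_zero, eval_zero]
    exact ((mul_eq_zero.1 this.symm).resolve_left (mul_ne_zero hN' hD'))
  · have e : (Q : ℝ) * aeval t ((N : ℤ[X]) * F) = ((D : ℤ) : ℝ) * (Q * (N * aeval t R)) := by
      rw [hval]; push_cast; ring
    rw [e]
    refine (distInt_int_mul_le _ _).trans ?_
    rw [Int.cast_natCast, Nat.abs_cast, mul_assoc]
    gcongr
    exact h Q δ hδ hj

/-- The arithmetic heart of the converse. Let `r = p / q` be a reduced fraction with `q ≤ Q`, close
to `t`, where `Q` is a good simultaneous approximation denominator for the values `P_j t`. Then, up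
to a constant factor, `Q` is divisible by `q ^ b` for each degree `b` in the span of the `P_j`. -/
lemma eventually_den_pow_dvd {k : ℕ} (P : Fin k → ℚ[X]) (hnd : NonDegenerate P) {d : ℕ}
    (hdeg : ∀ j, (P j).natDegree ≤ d) {θ : ℝ} (hθ : (d : ℝ) - k + 1 < θ) (hθ0 : 0 < θ) (t : ℝ)
    (b : ℕ) (hb : ∃ R ∈ Submodule.span ℚ (range (Fin.cons 1 P : Fin (k + 1) → ℚ[X])),
      R ≠ 0 ∧ R.natDegree = b) :
    ∃ c : ℕ, 0 < c ∧ ∀ᶠ Q : ℕ in atTop, ∀ r : ℚ, r.den ≤ Q →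
      |t - r| ≤ (Q : ℝ) ^ (-1 - θ) →
      (∀ j, distInt ((Q : ℝ) * aeval t (P j)) ≤ (Q : ℝ) ^ (-θ)) →
      (r.den : ℤ) ^ b ∣ c * Q := by
  set V := Submodule.span ℚ (range (Fin.cons 1 P : Fin (k + 1) → ℚ[X])) with hVdef
  have hV : Module.finrank ℚ V = k + 1 := finrank_span_of_nonDegenerate hnd
  have h1 : (1 : ℚ[X]) ∈ V := Submodule.subset_span ⟨0, rfl⟩
  have hVd : ∀ R ∈ V, R.natDegree ≤ d := fun R hR => natDegree_le_of_mem_span hdeg hR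
  induction b using Nat.strong_induction_on with
  | _ b ih =>
    rcases Nat.eq_zero_or_pos b with rfl | hb0
    · exact ⟨1, one_pos, Eventually.of_forall fun Q r _ _ _ => by simp⟩
    obtain ⟨R, hRV, hR0, hRb⟩ := hb
    obtain ⟨S, hSV, hS0, hSb, hgap⟩ := exists_natDegree_lt V hV h1 hVd hb0 (hRb ▸ hVd R hRV)
    obtain ⟨c, hc, hcQ⟩ := ih _ hSb ⟨S, hSV, hS0, rfl⟩
    obtain ⟨n, hn⟩ : ∃ n, b = S.natDegree + n := ⟨b - S.natDegree, by omega⟩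
    have hnθ : (n : ℝ) < θ := by
      have : (n : ℝ) + k ≤ d + 1 := by exact_mod_cast (by omega : n + k ≤ d + 1)
      linarith
    obtain ⟨F, C, hF0, hFb, hC, hF⟩ := exists_intPoly_of_mem_span P t hR0 hRV
    rw [hRb] at hFb
    obtain ⟨K, hK0, hK⟩ := exists_abs_aeval_sub_le F t
    set A := F.coeff b with hA
    have hA0 : A ≠ 0 := by rw [hA, ← hFb]; exact leadingCoeff_ne_zero.2 hF0
    refine ⟨c * A.natAbs ^ n, Nat.mul_pos hc (Nat.pow_pos (Int.natAbs_pos.2 hA0)), ?_⟩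
    filter_upwards [hcQ, eventually_gt_atTop 0,
      eventually_mul_rpow_lt (c * (C + K)) (x := n - θ) (η := 1) (by linarith) one_pos]
      with Q hQ hQ0 hsmall r hrQ hr hP
    have hQ0' : (0 : ℝ) < Q := by exact_mod_cast hQ0
    have hQ1 : (1 : ℝ) ≤ Q := by exact_mod_cast hQ0
    have hq0 : (0 : ℝ) < r.den := by exact_mod_cast r.den_pos
    obtain ⟨m, hm⟩ := hQ r hrQ hr hP
    obtain ⟨s, hs⟩ := exists_int_pow_mul_aeval_div F hFb.le r.num r.den_pos
    have hrr : (r.num : ℝ) / r.den = r := by exact_mod_cast Rat.num_div_den r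
    rw [hrr] at hs
    set x : ℤ := A * r.num ^ b + r.den * s with hx
    have hle1 : |t - r| ≤ 1 :=
      hr.trans (Real.rpow_le_one_of_one_le_of_nonpos hQ1 (by linarith))
    -- the number `c Q F(r)` has denominator dividing `q ^ n`, and it is close to an integer
    have hval : ((m * x : ℤ) : ℝ) / ((r.den : ℤ) ^ n : ℤ)
        = (c : ℤ) * ((Q : ℝ) * aeval (r : ℝ) F) := by
      have hm' : (c : ℝ) * Q = r.den ^ S.natDegree * m := by exact_mod_cast hm
      rw [Int.cast_mul, ← hs, hn]
      push_cast
      rw [← mul_assoc (c : ℝ), hm', pow_add]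
      field_simp
    have hdist : distInt ((Q : ℝ) * aeval (r : ℝ) F) ≤ (C + K) * (Q : ℝ) ^ (-θ) := by
      refine (distInt_le_add_abs_sub _ (Q * aeval t F)).trans ?_
      rw [← mul_sub, abs_mul, abs_of_pos hQ0', abs_sub_comm, add_mul]
      refine add_le_add (hF Q _ (by positivity) hP) ?_
      calc (Q : ℝ) * |aeval t F - aeval (r : ℝ) F| ≤ Q * (K * (Q : ℝ) ^ (-1 - θ)) := by
            gcongr
            exact (hK r hle1).trans (by gcongr)
        _ = K * (Q : ℝ) ^ (-θ) := by
            rw [show -θ = -1 - θ + 1 by ring, Real.rpow_add_one hQ0'.ne']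
            ring
    have hdvd : (r.den : ℤ) ^ n ∣ m * x := by
      refine dvd_of_distInt_div_lt (by have := r.den_pos; positivity) ?_
      rw [hval]
      refine (distInt_int_mul_le _ _).trans_lt ?_
      push_cast
      rw [Nat.abs_cast, lt_div_iff₀ (by positivity)]
      calc (c : ℝ) * distInt ((Q : ℝ) * aeval (r : ℝ) F) * (r.den : ℝ) ^ n
          ≤ c * ((C + K) * (Q : ℝ) ^ (-θ)) * (Q : ℝ) ^ n := by gcongr
        _ = c * (C + K) * (Q : ℝ) ^ (n - θ) := by
            rw [sub_eq_add_neg, Real.rpow_add hQ0', Real.rpow_natCast]; ring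
        _ < 1 := hsmall
    have hcop : IsCoprime r.num (r.den : ℤ) :=
      Int.isCoprime_iff_nat_coprime.2 (by simpa using r.reduced)
    have hdvd' : (r.den : ℤ) ^ n ∣ m * A ^ n := pow_dvd_mul_pow_of_dvd_mul hcop hdvd
    have hdvd2 : (r.den : ℤ) ^ b ∣ c * A ^ n * Q := by
      rw [hn, pow_add, show (c : ℤ) * A ^ n * Q = r.den ^ S.natDegree * (m * A ^ n) by
        linear_combination A ^ n * hm]
      exact mul_dvd_mul_left _ hdvd'
    rw [← Int.dvd_natAbs] at hdvd2 ⊢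
    convert hdvd2 using 2
    simp [Int.natAbs_mul, Int.natAbs_pow, Int.natAbs_abs]

/-- A simultaneous denominator `Q` of the `P_j t` yields an approximation of `t` by a fraction whose
reduced denominator is at most of order `Q ^ (1 / d)`. -/
theorem mem_H1_of_mem_H {k : ℕ} (hk : 0 < k) (P : Fin k → ℚ[X]) (hP1 : P ⟨0, hk⟩ = X)
    (hnd : NonDegenerate P) {d : ℕ} (hdeg : ∀ j, (P j).natDegree ≤ d) (hd0 : 0 < d)
    (hdV : ∃ j, (P j).natDegree = d) {lam t : ℝ} (hlam : (d : ℝ) - k + 1 < lam) (hlam0 : 0 < lam)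
    (ht : WithLp.toLp 2 (fun j => aeval t (P j)) ∈ H k lam) :
    t ∈ H1 ((d : ℝ) * lam + (d : ℝ) - 1) := by
  rw [mem_H1_iff]
  intro ε hε
  -- if a multiple of `t` is an integer there is nothing to prove
  by_cases hrat : ∃ q : ℕ, 0 < q ∧ distInt (q * t) = 0
  · obtain ⟨q, hq, h⟩ := hrat
    exact infinite_of_distInt_eq_zero hq h
  push Not at hrat
  have hd0' : (0 : ℝ) < d := by exact_mod_cast hd0
  obtain ⟨θ, hθlt, hθ1, hθ2, hθ3⟩ : ∃ θ, θ < lam ∧ (d : ℝ) - k + 1 < θ ∧ 0 < θ ∧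
      lam - ε / d < θ := by
    obtain ⟨θ, h1, h2⟩ := exists_between (a₁ := max (max ((d : ℝ) - k + 1) 0) (lam - ε / d))
      (a₂ := lam) (by
        have : 0 < ε / d := by positivity
        refine max_lt (max_lt hlam hlam0) (by linarith))
    rw [max_lt_iff, max_lt_iff] at h1
    exact ⟨θ, h2, h1.1.1, h1.1.2, h1.2⟩
  have hθε : -(d * θ) < -(d * lam) + ε := by
    have : d * (lam - ε / d) < d * θ := by gcongr
    rw [mul_sub, mul_div_cancel₀ _ hd0'.ne'] at this
    linarith
  obtain ⟨c, hc, hcQ⟩ := eventually_den_pow_dvd P hnd hdeg hθ1 hθ2 t d (by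
    obtain ⟨j, hj⟩ := hdV
    refine ⟨P j, Submodule.subset_span ⟨j.succ, by simp⟩, ?_, hj⟩
    rintro h0
    rw [h0, natDegree_zero] at hj
    omega)
  have hc' : (0 : ℝ) < c := by exact_mod_cast hc
  have hfreq := Nat.frequently_atTop_iff_infinite.2 (ht (lam - θ) (by linarith))
  obtain ⟨B₀, hB₀⟩ := eventually_atTop.1 (eventually_mul_rpow_lt ((c : ℝ) ^ (1 + θ))
    (x := -(d * θ) - (-(d * lam) + ε)) (η := 1) (by linarith) one_pos)
  refine infinite_of_forall_exists_gt fun B => ?_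
  -- large `Q` force large denominators
  have hlarge : ∀ᶠ Q : ℕ in atTop, ∀ q ∈ Finset.Icc 1 (max B B₀),
      (q : ℝ) * (Q : ℝ) ^ (-1 - θ) < distInt (q * t) := by
    rw [Filter.eventually_all_finset]
    intro q hq
    exact eventually_mul_rpow_lt _ (by linarith) (lt_of_le_of_ne (distInt_nonneg _)
      (hrat q (Finset.mem_Icc.1 hq).1).symm)
  obtain ⟨Q, ⟨hQ0, hQ⟩, hQc, hQl⟩ := (hfreq.and_eventually (hcQ.and hlarge)).exists
  rw [show -lam + (lam - θ) = -θ by ring] at hQ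
  have hQ0' : (0 : ℝ) < Q := by exact_mod_cast hQ0
  set r : ℚ := (round ((Q : ℝ) * t) : ℚ) / Q with hr
  have hrden : r.den ≤ Q := by
    have : (r.den : ℤ) ∣ Q := by
      rw [hr]; exact_mod_cast Rat.den_dvd (round ((Q : ℝ) * t)) Q
    exact Nat.le_of_dvd hQ0 (by exact_mod_cast this)
  have hrt : |t - r| ≤ (Q : ℝ) ^ (-1 - θ) := by
    have h1 : t - r = (Q * t - round ((Q : ℝ) * t)) / Q := by
      rw [hr]; push_cast; field_simp
    have h2 := hQ ⟨0, hk⟩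
    simp only [hP1, aeval_X] at h2
    rw [h1, abs_div, abs_of_pos hQ0', div_le_iff₀ hQ0', ← Real.rpow_add_one hQ0'.ne']
    rw [show -1 - θ + 1 = -θ by ring]
    exact h2
  have hdvd := hQc r hrden hrt hQ
  have hq0 : (0 : ℝ) < r.den := by exact_mod_cast r.den_pos
  have hqt : distInt (r.den * t) ≤ r.den * (Q : ℝ) ^ (-1 - θ) := by
    refine (distInt_le_abs_sub _ r.num).trans ?_
    have h1 : (r.den : ℝ) * t - r.num = r.den * (t - r) := by
      have : (r : ℝ) * r.den = r.num := by exact_mod_cast Rat.mul_den_eq_num r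
      rw [← this]; ring
    rw [h1, abs_mul, abs_of_pos hq0]
    gcongr
  have hbig : max B B₀ < r.den := by
    by_contra! hle
    exact absurd (hQl r.den (Finset.mem_Icc.2 ⟨r.den_pos, hle⟩)) (not_lt.2 hqt)
  rw [max_lt_iff] at hbig
  refine ⟨r.den, ⟨r.den_pos, hqt.trans ?_⟩, hbig.1⟩
  have hqQ : (r.den : ℝ) ^ d / c ≤ Q := by
    rw [div_le_iff₀' hc']
    exact_mod_cast Int.le_of_dvd (by positivity) hdvd
  have hlt := hB₀ r.den hbig.2.le
  calc (r.den : ℝ) * (Q : ℝ) ^ (-1 - θ)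
      ≤ r.den * ((r.den : ℝ) ^ d / c) ^ (-1 - θ) := by
        gcongr ?_ * ?_
        exact Real.rpow_le_rpow_of_nonpos (by positivity) hqQ (by linarith)
    _ = (c : ℝ) ^ (1 + θ) * (r.den : ℝ) ^ (-(d * θ) - (-(d * lam) + ε)) *
          (r.den : ℝ) ^ (-(d * lam + d - 1) + ε) := by
        rw [mul_assoc ((c : ℝ) ^ (1 + θ)), ← Real.rpow_add hq0, Real.div_rpow (by positivity) hc'.le,
          ← Real.rpow_natCast, ← Real.rpow_mul hq0.le,
          show -(d * θ) - (-(d * lam) + ε) + (-(d * lam + d - 1) + ε) = 1 + d * (-1 - θ) by ring,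
          Real.rpow_add hq0, Real.rpow_one, show (1 + θ) = -(-1 - θ) by ring,
          Real.rpow_neg hc'.le]
        ring
    _ ≤ 1 * (r.den : ℝ) ^ (-(d * lam + d - 1) + ε) := by gcongr
    _ = _ := one_mul _

/-! ### The upper bound in the Jarník–Besicovitch theorem -/

open MeasureTheory Measure in
theorem dimH_H1_le {μ : ℝ} (hμ : 0 < 1 + μ) : dimH (H1 μ) ≤ ENNReal.ofReal (2 / (1 + μ)) := by
  by_contra! hcon
  obtain ⟨s, hs1, hs2⟩ := ENNReal.lt_iff_exists_nnreal_btwn.1 hcon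
  refine absurd hs2 (not_lt.2 ?_)
  rw [ENNReal.ofReal_lt_coe_iff (by positivity)] at hs1
  have hs0 : (0 : ℝ) < s := lt_of_le_of_lt (by positivity) hs1
  obtain ⟨y, hy1, hy2⟩ : ∃ y : ℝ, 2 / (s : ℝ) < y ∧ y < 1 + μ :=
    exists_between (by rwa [div_lt_comm₀ hs0 hμ])
  have hy0 : 0 < y := lt_trans (by positivity) hy1
  have hys : 2 < y * s := by rwa [div_lt_iff₀ hs0] at hy1
  have hcover : H1 μ = ⋃ N : ℕ, H1 μ ∩ Icc (-(N : ℝ)) N := by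
    rw [← inter_iUnion, eq_comm, inter_eq_left]
    intro x _
    obtain ⟨N, hN⟩ := exists_nat_ge |x|
    exact mem_iUnion.2 ⟨N, abs_le.1 hN⟩
  rw [hcover, dimH_iUnion]
  refine iSup_le fun N => dimH_le_of_hausdorffMeasure_ne_top ?_
  -- the set is covered by balls around fractions with large denominators
  let f : ℕ → ℝ := fun q => (2 * N + 3) * 2 ^ (s : ℝ) * (q : ℝ) ^ (1 - y * s)
  have hf : Summable f := (Real.summable_nat_rpow.2 (by linarith)).mul_left _
  let ι : ℕ → Type := fun n => Σ i : ℕ, Fin (2 * (N + 1) * (n + i + 1) + 1)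
  let S : ∀ n, ι n → Set ℝ := fun n a =>
    Metric.closedBall ((((a.2 : ℕ) : ℝ) - (N + 1) * ((n + a.1 + 1 : ℕ) : ℝ)) / (n + a.1 + 1 : ℕ))
      (((n + a.1 + 1 : ℕ) : ℝ) ^ (-y))
  have hdiam : ∀ n a, Metric.ediam (S n a) ≤
      ENNReal.ofReal (2 * ((n + a.1 + 1 : ℕ) : ℝ) ^ (-y)) := fun n a => by
    simp only [S]
    rw [Real.closedBall_eq_Icc, Real.ediam_Icc]
    apply ENNReal.ofReal_le_ofReal
    apply le_of_eq
    ring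
  refine ne_top_of_le_ne_top hf.tsum_ofReal_ne_top ?_
  refine (hausdorffMeasure_le_liminf_tsum (s : ℝ) _ (l := atTop)
    (fun n : ℕ => ENNReal.ofReal (2 * ((n : ℝ) + 1) ^ (-y))) ?_ S ?_ ?_).trans ?_
  · have h1 := ((tendsto_natCast_rpow_atTop_zero (x := -y) (by linarith)).comp
      (tendsto_add_atTop_nat 1)).const_mul 2
    rw [mul_zero] at h1
    have h2 := ENNReal.tendsto_ofReal h1
    simpa [Function.comp_def] using h2
  · refine Eventually.of_forall fun n a => (hdiam n a).trans (ENNReal.ofReal_le_ofReal ?_)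
    gcongr 2 * ?_
    refine Real.rpow_le_rpow_of_nonpos (by positivity) ?_ (by linarith)
    push_cast
    have : (0 : ℝ) ≤ a.1 := by positivity
    linarith
  · refine Eventually.of_forall fun n ζ hζ => ?_
    have hinf := mem_H1_iff.1 hζ.1 (1 + μ - y) (by linarith)
    obtain ⟨q, ⟨hq0, hq⟩, hqn⟩ := hinf.exists_gt n
    have hq0' : (0 : ℝ) < q := by exact_mod_cast hq0
    have hq1 : (1 : ℝ) ≤ q := by exact_mod_cast hq0
    obtain ⟨i, rfl⟩ : ∃ i, q = n + i + 1 := ⟨q - n - 1, by omega⟩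
    set q := n + i + 1
    set p := round ((q : ℝ) * ζ)
    have hp : |(q : ℝ) * ζ - p| ≤ 1 / 2 := abs_sub_round _
    have hp' := abs_le.1 hp
    have hζ1 : -(q * N : ℝ) ≤ q * ζ := by rw [← mul_neg]; gcongr; exact hζ.2.1
    have hζ2 : (q : ℝ) * ζ ≤ q * N := by gcongr; exact hζ.2.2
    have hp1 : 0 ≤ p + (N + 1) * q := by
      have : (0 : ℝ) ≤ p + (N + 1) * q := by nlinarith
      exact_mod_cast this
    have hp2 : p + (N + 1) * q ≤ 2 * (N + 1) * q := by
      have : (p : ℝ) + (N + 1) * q ≤ 2 * (N + 1) * q := by nlinarith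
      exact_mod_cast this
    obtain ⟨j, hj⟩ := Int.eq_ofNat_of_zero_le hp1
    have hjlt : j < 2 * (N + 1) * q + 1 := by
      have : (j : ℤ) < 2 * (N + 1) * q + 1 := by omega
      exact_mod_cast this
    refine mem_iUnion.2 ⟨⟨i, ⟨j, hjlt⟩⟩, ?_⟩
    have hj' : (j : ℝ) - (N + 1) * (q : ℝ) = p := by
      have : (p : ℝ) + (N + 1) * q = j := by exact_mod_cast hj
      linarith
    change ζ ∈ Metric.closedBall (((j : ℝ) - (N + 1) * (q : ℝ)) / q) ((q : ℝ) ^ (-y))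
    rw [hj', Metric.mem_closedBall, Real.dist_eq]
    have e : ζ - p / q = (q * ζ - p) / q := by field_simp
    rw [e, abs_div, abs_of_pos hq0', div_le_iff₀ hq0', ← Real.rpow_add_one hq0'.ne',
      show -y + 1 = -μ + (1 + μ - y) by ring]
    exact hq
  · refine liminf_le_of_le (by isBoundedDefault) fun b hb => ?_
    obtain ⟨n, hn⟩ := hb.exists
    refine hn.trans ?_
    rw [ENNReal.tsum_sigma']
    refine le_trans ?_ (ENNReal.tsum_comp_le_tsum_of_injective (f := fun i : ℕ => n + i + 1)
      (fun a b h => by simpa using h) fun q => ENNReal.ofReal (f q))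
    refine ENNReal.tsum_le_tsum fun i => ?_
    set q := n + i + 1 with hq
    have hq1 : (1 : ℝ) ≤ q := by exact_mod_cast (by omega : 1 ≤ q)
    have hq0' : (0 : ℝ) < q := by linarith
    calc ∑' b : Fin (2 * (N + 1) * q + 1), Metric.ediam (S n ⟨i, b⟩) ^ (s : ℝ)
        ≤ ∑' b : Fin (2 * (N + 1) * q + 1), ENNReal.ofReal ((2 * (q : ℝ) ^ (-y)) ^ (s : ℝ)) := by
          refine ENNReal.tsum_le_tsum fun b => ?_
          rw [← ENNReal.ofReal_rpow_of_nonneg (p := (s : ℝ)) (by positivity) s.2]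
          exact ENNReal.rpow_le_rpow (hdiam n ⟨i, b⟩) s.2
      _ = ENNReal.ofReal ((2 * (N + 1) * q + 1) * (2 * (q : ℝ) ^ (-y)) ^ (s : ℝ)) := by
          rw [tsum_fintype, Finset.sum_const, Finset.card_univ, Fintype.card_fin, nsmul_eq_mul,
            ENNReal.ofReal_mul (by positivity)]
          congr 1
          rw [← ENNReal.ofReal_natCast]
          push_cast
          rfl
      _ ≤ ENNReal.ofReal (f q) := by
          apply ENNReal.ofReal_le_ofReal
          change _ ≤ (2 * N + 3) * 2 ^ (s : ℝ) * (q : ℝ) ^ (1 - y * s)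
          rw [Real.mul_rpow (by positivity) (by positivity), ← Real.rpow_mul hq0'.le,
            sub_eq_add_neg, Real.rpow_add hq0', Real.rpow_one, neg_mul]
          have : (2 * ((N : ℝ) + 1) * q + 1) ≤ (2 * N + 3) * q := by linarith
          calc (2 * ((N : ℝ) + 1) * q + 1) * (2 ^ (s : ℝ) * (q : ℝ) ^ (-(y * s)))
              ≤ ((2 * N + 3) * q) * (2 ^ (s : ℝ) * (q : ℝ) ^ (-(y * s))) := by gcongr
            _ = _ := by ring

/-! ### Counting fractions with denominators of a given size -/

/-- By Dirichlet's theorem the balls of radius `1 / (N q)` around the fractions `p / q` with `q ≤ N`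
cover the line. The fractions with `q ≤ N / 16` only cover a small proportion of a given interval
when `N` is large, so that there must be many fractions with larger denominators. -/
lemma eventually_exists_finset_rat {l : ℝ} (hl : 0 < l) :
    ∀ᶠ N : ℕ in atTop, ∀ a : ℝ, ∃ F : Finset ℚ,
      (∀ r ∈ F, a ≤ r ∧ (r : ℝ) ≤ a + l / 2 ∧ r.den ≤ N ∧ N < 16 * r.den) ∧
      l * (N : ℝ) ^ 2 / 256 ≤ F.card := by
  have hlog : ∀ᶠ N : ℕ in atTop, 2 * ((1 + Real.log N) / N) < l / 16 := by
    have h1 : Tendsto (fun N : ℕ => ((N : ℝ))⁻¹ + Real.log N / N) atTop (𝓝 (0 + 0)) := by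
      refine tendsto_inv_atTop_nhds_zero_nat.add ?_
      exact (Real.isLittleO_log_id_atTop.tendsto_div_nhds_zero).comp tendsto_natCast_atTop_atTop
    have h2 := h1.const_mul 2
    rw [add_zero, mul_zero] at h2
    filter_upwards [h2.eventually_lt_const (show 0 < l / 16 by positivity)] with N hN
    rwa [add_div, one_div]
  have hinv : ∀ᶠ N : ℕ in atTop, ((N : ℝ))⁻¹ < l / 8 :=
    tendsto_inv_atTop_nhds_zero_nat.eventually_lt_const (by positivity)
  filter_upwards [hlog, hinv, eventually_gt_atTop 0] with N hN1 hN2 hN0 a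
  have hN0' : (0 : ℝ) < N := by exact_mod_cast hN0
  have hN1' : (1 : ℝ) ≤ N := by exact_mod_cast hN0
  set n := N / 16 with hn
  have hnN : (n : ℝ) ≤ N / 16 := by
    rw [le_div_iff₀ (by norm_num)]
    exact_mod_cast Nat.div_mul_le_self N 16
  let G : ℕ → Finset ℤ := fun q => Finset.Icc ⌈(q : ℝ) * a⌉ ⌊(q : ℝ) * (a + l / 2)⌋
  have hG : ∀ q p, p ∈ G q ↔ (q : ℝ) * a ≤ p ∧ (p : ℝ) ≤ q * (a + l / 2) := fun q p => by
    rw [Finset.mem_Icc, Int.ceil_le, Int.le_floor]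
  have hGcard : ∀ q, ((G q).card : ℝ) ≤ q * (l / 2) + 1 := fun q => by
    rw [Int.card_Icc]
    have h1 := Int.floor_le ((q : ℝ) * (a + l / 2))
    have h2 := Int.le_ceil ((q : ℝ) * a)
    have h3 : (0 : ℝ) ≤ q * (l / 2) + 1 := by positivity
    rcases le_total 0 (⌊(q : ℝ) * (a + l / 2)⌋ + 1 - ⌈(q : ℝ) * a⌉) with h | h
    · have h4 : (((⌊(q : ℝ) * (a + l / 2)⌋ + 1 - ⌈(q : ℝ) * a⌉).toNat : ℤ) : ℝ)
          = ⌊(q : ℝ) * (a + l / 2)⌋ + 1 - ⌈(q : ℝ) * a⌉ := by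
        rw [Int.toNat_of_nonneg h]; push_cast; ring
      rw [Int.cast_natCast] at h4
      rw [h4]
      linarith
    · rw [Int.toNat_of_nonpos h]
      simpa using h3
  let F : Finset ℚ := ((Finset.Icc 1 N).biUnion fun q =>
    (G q).image fun p : ℤ => (p : ℚ) / q).filter fun r => n < r.den ∧ r.den ≤ N
  refine ⟨F, fun r hr => ?_, ?_⟩
  · obtain ⟨h1, h2, h3⟩ := Finset.mem_filter.1 hr
    obtain ⟨q, hq, hpG⟩ := Finset.mem_biUnion.1 h1
    obtain ⟨p, hp, rfl⟩ := Finset.mem_image.1 hpG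
    have hq0 : (0 : ℝ) < q := by exact_mod_cast (Finset.mem_Icc.1 hq).1
    obtain ⟨hp1, hp2⟩ := (hG q p).1 hp
    refine ⟨?_, ?_, h3, ?_⟩
    · push_cast
      rwa [le_div_iff₀' hq0]
    · push_cast
      rwa [div_le_iff₀' hq0]
    · omega
  have hcover : Icc (a + l / 8) (a + 3 * l / 8) ⊆
      (⋃ q ∈ Finset.Icc 1 n, ⋃ p ∈ G q, Metric.closedBall ((p : ℝ) / q) (1 / (N * q))) ∪
      ⋃ r ∈ F, Metric.closedBall (r : ℝ) (16 / (N : ℝ) ^ 2) := by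
    intro x hx
    obtain ⟨r, hr1, hr2⟩ := Real.exists_rat_abs_sub_le_and_den_le x hN0
    have hq0 : (0 : ℝ) < r.den := by exact_mod_cast r.den_pos
    have hq1 : (1 : ℝ) ≤ r.den := by exact_mod_cast r.den_pos
    have hrr : (r : ℝ) * r.den = r.num := by exact_mod_cast Rat.mul_den_eq_num r
    have hr3 : |x - r| ≤ 1 / (N * r.den) := hr1.trans (by gcongr; linarith)
    have hr4 : |x - r| ≤ l / 8 := by
      refine hr3.trans (le_trans ?_ hN2.le)
      rw [inv_eq_one_div]
      gcongr
      nlinarith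
    have hr5 := abs_le.1 hr4
    have hmem : r.num ∈ G r.den := by
      rw [hG, ← hrr, mul_comm (r : ℝ)]
      constructor <;> gcongr <;> linarith [hx.1, hx.2]
    by_cases hrn : r.den ≤ n
    · refine Or.inl (mem_biUnion (Finset.mem_coe.2 (Finset.mem_Icc.2 ⟨r.den_pos, hrn⟩))
        (mem_biUnion (Finset.mem_coe.2 hmem) ?_))
      rw [Metric.mem_closedBall, Real.dist_eq, ← hrr, mul_div_cancel_right₀ _ hq0.ne']
      exact hr3
    · refine Or.inr (mem_biUnion (x := r) (Finset.mem_coe.2 (Finset.mem_filter.2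
        ⟨Finset.mem_biUnion.2 ⟨r.den, Finset.mem_Icc.2 ⟨r.den_pos, hr2⟩,
          Finset.mem_image.2 ⟨r.num, hmem, Rat.num_div_den r⟩⟩, by omega, hr2⟩)) ?_)
      rw [Metric.mem_closedBall, Real.dist_eq]
      refine hr3.trans ?_
      rw [div_le_div_iff₀ (by positivity) (by positivity)]
      have : (N : ℝ) ≤ 16 * r.den := by exact_mod_cast (by omega : N ≤ 16 * r.den)
      nlinarith
  have hvol : l / 4 ≤ (∑ q ∈ Finset.Icc 1 n, ∑ _p ∈ G q, 2 * (1 / ((N : ℝ) * q))) +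
      ∑ _r ∈ F, 2 * (16 / (N : ℝ) ^ 2) := by
    rw [← ENNReal.ofReal_le_ofReal_iff (by positivity), ENNReal.ofReal_add (by positivity)
      (by positivity), ENNReal.ofReal_sum_of_nonneg (fun _ _ => by positivity),
      ENNReal.ofReal_sum_of_nonneg (fun _ _ => by positivity)]
    calc ENNReal.ofReal (l / 4) = MeasureTheory.volume (Icc (a + l / 8) (a + 3 * l / 8)) := by
          rw [Real.volume_Icc]; congr 1; ring
      _ ≤ _ := MeasureTheory.measure_mono hcover
      _ ≤ _ := MeasureTheory.measure_union_le _ _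
      _ ≤ _ := by
          refine add_le_add ?_ ?_
          · refine (MeasureTheory.measure_biUnion_finset_le _ _).trans ?_
            refine Finset.sum_le_sum fun q _ => ?_
            rw [ENNReal.ofReal_sum_of_nonneg (fun _ _ => by positivity)]
            refine (MeasureTheory.measure_biUnion_finset_le _ _).trans ?_
            exact Finset.sum_le_sum fun p _ => (Real.volume_closedBall _ _).le
          · refine (MeasureTheory.measure_biUnion_finset_le _ _).trans ?_
            exact Finset.sum_le_sum fun p _ => (Real.volume_closedBall _ _).le
  have hsmall : (∑ q ∈ Finset.Icc 1 n, ∑ _p ∈ G q, 2 * (1 / ((N : ℝ) * q))) ≤ l / 8 := by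
    have hharm : ∑ q ∈ Finset.Icc 1 n, ((q : ℝ))⁻¹ ≤ 1 + Real.log N := by
      have h1 := harmonic_le_one_add_log n
      rw [harmonic_eq_sum_Icc] at h1
      push_cast at h1
      refine h1.trans ?_
      rcases Nat.eq_zero_or_pos n with h0 | h0
      · rw [h0]
        simpa using Real.log_nonneg hN1'
      · gcongr
        exact Nat.div_le_self N 16
    calc (∑ q ∈ Finset.Icc 1 n, ∑ _p ∈ G q, 2 * (1 / ((N : ℝ) * q)))
        ≤ ∑ q ∈ Finset.Icc 1 n, (l / N + 2 / N * ((q : ℝ))⁻¹) := by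
          refine Finset.sum_le_sum fun q hq => ?_
          have hq0 : (0 : ℝ) < q := by exact_mod_cast (Finset.mem_Icc.1 hq).1
          rw [Finset.sum_const, nsmul_eq_mul]
          calc _ ≤ ((q : ℝ) * (l / 2) + 1) * (2 * (1 / ((N : ℝ) * q))) := by
                gcongr; exact hGcard q
            _ = _ := by field_simp
      _ = n * l / N + 2 / N * ∑ q ∈ Finset.Icc 1 n, ((q : ℝ))⁻¹ := by
          rw [Finset.sum_add_distrib, Finset.sum_const, Nat.card_Icc, ← Finset.mul_sum,
            nsmul_eq_mul, Nat.add_sub_cancel, mul_div_assoc]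
      _ ≤ N / 16 * l / N + 2 / N * (1 + Real.log N) := by gcongr
      _ = l / 16 + 2 * ((1 + Real.log N) / N) := by field_simp
      _ ≤ l / 8 := by linarith
  rw [Finset.sum_const, nsmul_eq_mul] at hvol
  have h1 : l / 8 ≤ F.card * (2 * (16 / (N : ℝ) ^ 2)) := by linarith
  have h2 : (F.card : ℝ) * (2 * (16 / (N : ℝ) ^ 2)) = F.card * 32 / (N : ℝ) ^ 2 := by ring
  rw [h2, le_div_iff₀ (by positivity)] at h1
  linarith

/-! ### The lower bound in the Jarník–Besicovitch theorem -/

/-- A finite stage of a Cantor construction of dimension at least `r`: the `M` disjoint intervals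
`[L i, L i + l]`, `i < M`, of the same length `l`, with `M l ^ r ≥ 1`. The values `L i` for `i ≥ M`
are irrelevant. -/
structure CantorStage (r : ℝ) where
  /-- the common length of the intervals -/
  l : ℝ
  /-- the number of intervals -/
  M : ℕ
  /-- the left end points, in increasing order -/
  L : ℕ → ℚ
  l_pos : 0 < l
  M_pos : 0 < M
  sep : ∀ i j, i < j → j < M → (L i : ℝ) + l < L j
  mass : 1 ≤ M * l ^ r

/-- Distinct fractions with denominators at most `N` are `1 / N ^ 2`-separated. -/
lemma sub_div_sq_le_of_strictMono {N M : ℕ} (L : ℕ → ℚ) (hN : ∀ k, (L k).den ≤ N)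
    (hL : ∀ i j, i < j → j < M → L i < L j) {i j : ℕ} (hij : i ≤ j) (hj : j < M) :
    ((j : ℝ) - i) / (N : ℝ) ^ 2 ≤ L j - L i := by
  induction j, hij using Nat.le_induction with
  | base => simp
  | succ j hij ih =>
    have h1 := ih (by omega)
    have h2 := hL j (j + 1) (by omega) hj
    have hd0 : (0 : ℝ) < (L j).den := by exact_mod_cast (L j).den_pos
    have hd1 : (0 : ℝ) < (L (j + 1)).den := by exact_mod_cast (L (j + 1)).den_pos
    have e0 : (L j : ℝ) * (L j).den = (L j).num := by exact_mod_cast Rat.mul_den_eq_num _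
    have e1 : (L (j + 1) : ℝ) * (L (j + 1)).den = (L (j + 1)).num := by
      exact_mod_cast Rat.mul_den_eq_num _
    have hN0 : ((L j).den : ℝ) ≤ N := by exact_mod_cast hN j
    have hN1 : ((L (j + 1)).den : ℝ) ≤ N := by exact_mod_cast hN (j + 1)
    have hpos : (0 : ℝ) < L (j + 1) - L j := sub_pos.2 (by exact_mod_cast h2)
    have e2 : ((L (j + 1) : ℝ) - L j) * ((L j).den * (L (j + 1)).den)
        = (((L (j + 1)).num * (L j).den - (L j).num * (L (j + 1)).den : ℤ) : ℝ) := by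
      push_cast
      rw [← e0, ← e1]
      ring
    have h3 : (1 : ℝ) ≤ ((L (j + 1) : ℝ) - L j) * ((L j).den * (L (j + 1)).den) := by
      have h4 : 0 < ((L (j + 1) : ℝ) - L j) * ((L j).den * (L (j + 1)).den) := by positivity
      rw [e2] at h4 ⊢
      exact_mod_cast Int.cast_pos.1 h4
    have h5 : 1 / (N : ℝ) ^ 2 ≤ L (j + 1) - L j := by
      have hNpos : (0 : ℝ) < N := hd0.trans_le hN0
      rw [div_le_iff₀ (by positivity), sq]
      refine h3.trans ?_
      gcongr
    push_cast
    rw [show (j : ℝ) + 1 - i = (j - i) + 1 by ring, add_div]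
    linarith

/-- The inductive step of the Cantor construction: inside each interval, keep the short intervals
to the right of many fractions with denominators of a same large size. -/
lemma CantorStage.exists_next {μ r : ℝ} (hμ : 1 < μ) (hr : r * (1 + μ) < 2) (A : CantorStage r)
    (n : ℕ) : ∃ (B : CantorStage r) (m : ℕ), 2 ≤ m ∧ B.M = A.M * m ∧
      (∀ k, (A.L (k / m) : ℝ) ≤ B.L k ∧ (B.L k : ℝ) + B.l ≤ A.L (k / m) + A.l) ∧
      (∀ i j, i < j → j < B.M →
        ((j : ℝ) - i) * (A.l / (512 * m)) ≤ B.L j - B.L i - B.l) ∧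
      (∀ k x, (B.L k : ℝ) ≤ x → x ≤ B.L k + B.l →
        ∃ q : ℕ, n < q ∧ distInt (q * x) ≤ (q : ℝ) ^ (-μ)) := by
  have hl := A.l_pos
  obtain ⟨N, hcount, hN0, hNn, hN2, hNl, hNm, hNmass⟩ :=
    ((eventually_exists_finset_rat hl).and <| (eventually_gt_atTop 0).and <|
    (eventually_ge_atTop (16 * n)).and <|
    (eventually_mul_rpow_lt 1 (x := 1 - μ) (η := 1 / 2) (by linarith) (by norm_num)).and <|
    (eventually_mul_rpow_lt 1 (x := -1 - μ) (η := A.l / 2) (by linarith) (by positivity)).and <|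
    (eventually_mul_rpow_lt 1 (x := -1) (η := A.l / 512) (by norm_num) (by positivity)).and
    (eventually_mul_rpow_lt 1 (x := r * (1 + μ) - 2) (η := A.l / 256) (by linarith)
      (by positivity))).exists
  rw [one_mul] at hN2 hNl hNm hNmass
  have hN0' : (0 : ℝ) < N := by exact_mod_cast hN0
  have hN1 : (1 : ℝ) ≤ N := by exact_mod_cast hN0
  set l' : ℝ := (N : ℝ) ^ (-1 - μ) with hl'
  have hl'pos : 0 < l' := by positivity
  set m : ℕ := ⌈A.l * (N : ℝ) ^ 2 / 256⌉₊ with hm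
  have hmle : A.l * (N : ℝ) ^ 2 / 256 ≤ m := Nat.le_ceil _
  have hm2 : 2 ≤ m := by
    rw [Real.rpow_neg_one, inv_lt_iff_one_lt_mul₀ hN0'] at hNm
    have h1 : (1 : ℝ) < m := by nlinarith
    exact_mod_cast h1
  choose F hF hFcard using hcount
  have hsub : ∀ a, ∃ T ⊆ F a, T.card = m := fun a =>
    Finset.exists_subset_card_eq (Nat.ceil_le.2 (hFcard a))
  choose T hTF hT using hsub
  let L' : ℕ → ℚ := fun k =>
    (T (A.L (k / m))).orderEmbOfFin (hT _) ⟨k % m, Nat.mod_lt _ (by omega)⟩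
  have hL'F : ∀ k, L' k ∈ F (A.L (k / m)) := fun k => hTF _ (Finset.orderEmbOfFin_mem _ _ _)
  have hmono : ∀ i j, i < j → j < A.M * m → L' i < L' j := by
    intro i j hij hj
    rcases eq_or_lt_of_le (Nat.div_le_div_right (c := m) hij.le) with h | h
    · have hmod : i % m < j % m := by
        have h1 := Nat.div_add_mod i m
        have h2 := Nat.div_add_mod j m
        rw [h] at h1
        omega
      simp only [L']
      rw! [h]
      exact OrderEmbedding.lt_iff_lt _ |>.2 hmod
    · have h1 := A.sep _ _ h (Nat.div_lt_of_lt_mul (by rwa [mul_comm]))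
      have h2 := (hF _ _ (hL'F i)).2.1
      have h3 := (hF _ _ (hL'F j)).1
      have : (L' i : ℝ) < L' j := by linarith
      exact_mod_cast this
  have hl'N : l' ≤ 1 / (2 * (N : ℝ) ^ 2) := by
    rw [le_div_iff₀ (by positivity)]
    have h1 : l' * (N : ℝ) ^ 2 = (N : ℝ) ^ (1 - μ) := by
      rw [hl', ← Real.rpow_natCast, ← Real.rpow_add hN0']
      congr 1
      push_cast
      ring
    linarith
  have hgap : ∀ i j, i < j → j < A.M * m →
      ((j : ℝ) - i) * (1 / (2 * (N : ℝ) ^ 2)) ≤ L' j - L' i - l' := by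
    intro i j hij hj
    have h1 := sub_div_sq_le_of_strictMono L' (fun k => (hF _ _ (hL'F k)).2.2.1) hmono hij.le hj
    have h2 : (1 : ℝ) ≤ (j : ℝ) - i := by
      have : (i : ℝ) + 1 ≤ j := by exact_mod_cast hij
      linarith
    have h3 : ((j : ℝ) - i) / (N : ℝ) ^ 2 = 2 * (((j : ℝ) - i) * (1 / (2 * (N : ℝ) ^ 2))) := by
      field_simp
    have h4 : 1 / (2 * (N : ℝ) ^ 2) ≤ ((j : ℝ) - i) * (1 / (2 * (N : ℝ) ^ 2)) :=
      le_mul_of_one_le_left (by positivity) h2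
    linarith
  have hmass : 1 ≤ ((A.M * m : ℕ) : ℝ) * l' ^ r := by
    have h1 : (1 : ℝ) ≤ A.M := by exact_mod_cast A.M_pos
    have h2 : (N : ℝ) ^ (r * (1 + μ) - 2) * ((N : ℝ) ^ 2 * l' ^ r) = 1 := by
      rw [hl', ← Real.rpow_natCast, ← Real.rpow_mul hN0'.le, ← Real.rpow_add hN0',
        ← Real.rpow_add hN0']
      convert Real.rpow_zero _ using 2
      push_cast
      ring
    calc (1 : ℝ) ≤ A.l / 256 * ((N : ℝ) ^ 2 * l' ^ r) := by
          rw [← h2]; gcongr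
      _ = 1 * (A.l * (N : ℝ) ^ 2 / 256) * l' ^ r := by ring
      _ ≤ A.M * m * l' ^ r := by gcongr
      _ = _ := by push_cast; ring
  refine ⟨⟨l', A.M * m, L', hl'pos, Nat.mul_pos A.M_pos (by omega), fun i j hij hj => ?_, hmass⟩, m,
    hm2, rfl, fun k => ⟨(hF _ _ (hL'F k)).1, ?_⟩, fun i j hij hj => ?_, fun k x hx1 hx2 => ?_⟩
  · have h1 := hgap i j hij hj
    have h2 : (0 : ℝ) < (j : ℝ) - i := sub_pos.2 (by exact_mod_cast hij)
    have h3 : 0 < ((j : ℝ) - i) * (1 / (2 * (N : ℝ) ^ 2)) := by positivity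
    linarith
  · have := (hF _ _ (hL'F k)).2.1
    change (L' k : ℝ) + l' ≤ _
    linarith
  · refine le_trans ?_ (hgap i j hij hj)
    have h2 : (0 : ℝ) < (j : ℝ) - i := sub_pos.2 (by exact_mod_cast hij)
    gcongr ?_ * ?_
    have hm0 : (0 : ℝ) < m := by positivity
    rw [div_le_div_iff₀ (by positivity) (by positivity)]
    linarith
  · obtain ⟨_, _, hden, hden'⟩ := hF _ _ (hL'F k)
    refine ⟨(L' k).den, by omega, ?_⟩
    have hd0 : (0 : ℝ) < (L' k).den := by exact_mod_cast (L' k).den_pos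
    have hden2 : ((L' k).den : ℝ) ≤ N := by exact_mod_cast hden
    refine (distInt_le_abs_sub _ (L' k).num).trans ?_
    have e : ((L' k).den : ℝ) * x - (L' k).num = (x - L' k) * (L' k).den := by
      have : (L' k : ℝ) * (L' k).den = (L' k).num := by exact_mod_cast Rat.mul_den_eq_num _
      rw [← this]; ring
    have hx1' : (L' k : ℝ) ≤ x := hx1
    have hx2' : x ≤ (L' k : ℝ) + l' := hx2
    rw [e, abs_mul, abs_of_pos hd0, abs_of_nonneg (by linarith),
      show -μ = -1 - μ + 1 by ring, Real.rpow_add_one hd0.ne']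
    gcongr
    calc x - L' k ≤ l' := by linarith
      _ ≤ _ := Real.rpow_le_rpow_of_nonpos hd0 hden2 (by linarith)

/-- A map whose inverse is Hölder continuous of exponent `r` multiplies dimensions by `r` at
least. -/
lemma mul_dimH_le_dimH_image {g : ℝ → ℝ} {S : Set ℝ} {C r : NNReal} (hr : 0 < r)
    (h : ∀ y ∈ S, ∀ y' ∈ S, y < y' → y' - y ≤ C * |g y' - g y| ^ (r : ℝ)) :
    r * dimH S ≤ dimH (g '' S) := by
  have hr' : (0 : ℝ) < r := hr
  have h' : ∀ y ∈ S, ∀ y' ∈ S, |y - y'| ≤ C * |g y - g y'| ^ (r : ℝ) := by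
    intro y hy y' hy'
    rcases lt_trichotomy y y' with hlt | rfl | hlt
    · rw [abs_sub_comm, abs_of_pos (sub_pos.2 hlt), abs_sub_comm (g y)]
      exact h y hy y' hy' hlt
    · simp [Real.zero_rpow hr'.ne']
    · rw [abs_of_pos (sub_pos.2 hlt)]
      exact h y' hy' y hy hlt
  have hinj : InjOn g S := fun y hy y' hy' he => by
    have := h' y hy y' hy'
    rw [he, sub_self, abs_zero, Real.zero_rpow hr'.ne', mul_zero] at this
    exact sub_eq_zero.1 (abs_eq_zero.1 (le_antisymm this (abs_nonneg _)))
  set f := Function.invFunOn g S with hf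
  have hfg : ∀ y ∈ S, f (g y) = y := fun y hy => hinj.leftInvOn_invFunOn hy
  have hH : HolderOnWith C r f (g '' S) := by
    rintro _ ⟨y, hy, rfl⟩ _ ⟨y', hy', rfl⟩
    rw [hfg y hy, hfg y' hy', edist_dist, edist_dist, Real.dist_eq, Real.dist_eq,
      ENNReal.ofReal_rpow_of_nonneg (abs_nonneg _) hr'.le, ← ENNReal.ofReal_coe_nnreal,
      ← ENNReal.ofReal_mul C.coe_nonneg]
    exact ENNReal.ofReal_le_ofReal (h' y hy y' hy')
  have himg : f '' (g '' S) = S := by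
    rw [← image_comp]
    ext y
    constructor
    · rintro ⟨z, hz, rfl⟩
      rwa [Function.comp_apply, hfg z hz]
    · exact fun hy => ⟨y, hy, hfg y hy⟩
  have := hH.dimH_image_le hr
  rw [himg, ENNReal.le_div_iff_mul_le (Or.inl (by exact_mod_cast hr.ne')) (Or.inl (by simp))]
    at this
  rwa [mul_comm]

/-- The points of a Cantor set in `H1 μ` are indexed by `[0, 1)`: at the stage with `M` intervals,
`y` selects the interval of index `⌊M y⌋`. If `y` and `y'` are separated at the stage following one
with `a` intervals of length `l`, being `j` intervals apart among the `m` new ones, then `|y' - y|`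
is at most `1 / a` and `2 j / (a m)`, while the distance of the points is at least of order
`j l / m`. The Hölder estimate follows by interpolation, since `a l ^ r ≥ 1`. -/
lemma le_dimH_H1 {μ : ℝ} (hμ : 1 < μ) {r : NNReal} (hr0 : 0 < r) (hr : r * (1 + μ) < 2) :
    (r : ENNReal) ≤ dimH (H1 μ) := by
  have hr0' : (0 : ℝ) < r := hr0
  have hr1 : (r : ℝ) ≤ 1 := by nlinarith
  choose next m hm2 hM hnest hgap happ using CantorStage.exists_next hμ hr
  let A : ℕ → CantorStage r := fun n => Nat.rec
    ⟨1, 1, fun _ => 0, one_pos, one_pos, fun i j _ _ => by omega, by simp⟩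
    (fun n B => next B n) n
  have hA : ∀ n, A (n + 1) = next (A n) n := fun n => rfl
  -- a number `y` in `[0, 1)` is sent to the point of the intervals of indices `⌊M_n y⌋`
  let idx : ℕ → ℝ → ℕ := fun n y => ⌊y * (A n).M⌋₊
  have hidx : ∀ n y, idx (n + 1) y / m (A n) n = idx n y := by
    intro n y
    have h0 : (m (A n) n : ℝ) ≠ 0 := by
      have := hm2 (A n) n
      positivity
    simp only [idx]
    rw [← Nat.floor_div_natCast, hA, hM]
    push_cast
    rw [← mul_assoc, mul_div_cancel_right₀ _ h0]
  have hex : ∀ y, ∃ x : ℝ, ∀ n, ((A n).L (idx n y) : ℝ) ≤ x ∧ x ≤ (A n).L (idx n y) + (A n).l := by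
    intro y
    have hstep : ∀ n, ((A n).L (idx n y) : ℝ) ≤ (A (n + 1)).L (idx (n + 1) y) ∧
        ((A (n + 1)).L (idx (n + 1) y) : ℝ) + (A (n + 1)).l ≤ (A n).L (idx n y) + (A n).l := by
      intro n
      have := hnest (A n) n (idx (n + 1) y)
      rwa [hidx] at this
    have := Monotone.ciSup_mem_iInter_Icc_of_antitone
      (f := fun n => ((A n).L (idx n y) : ℝ)) (g := fun n => ((A n).L (idx n y) : ℝ) + (A n).l)
      (monotone_nat_of_le_succ fun n => (hstep n).1) (antitone_nat_of_succ_le fun n => (hstep n).2)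
      (fun n => by simpa using (A n).l_pos.le)
    rw [mem_iInter] at this
    exact ⟨_, this⟩
  choose g hg using hex
  have hgH1 : g '' Ico 0 1 ⊆ H1 μ := by
    rintro _ ⟨y, -, rfl⟩
    rw [mem_H1_iff]
    intro ε hε
    refine infinite_of_forall_exists_gt fun n => ?_
    have h := hg y (n + 1)
    rw [hA] at h
    obtain ⟨q, hq, hqd⟩ := happ (A n) n _ _ h.1 h.2
    have hq1 : (1 : ℝ) ≤ q := by exact_mod_cast Nat.one_le_of_lt hq
    exact ⟨q, ⟨by omega, hqd.trans (Real.rpow_le_rpow_of_exponent_le hq1 (by linarith))⟩, hq⟩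
  have hMpow : ∀ n, 2 ^ n ≤ (A n).M := by
    intro n
    induction n with
    | zero => exact (A 0).M_pos
    | succ n ih =>
      rw [hA, hM, pow_succ]
      exact Nat.mul_le_mul ih (hm2 _ _)
  have hholder : ∀ y ∈ Ico (0 : ℝ) 1, ∀ y' ∈ Ico (0 : ℝ) 1, y < y' →
      y' - y ≤ ((1024 ^ (r : ℝ) : NNReal) : ℝ) * |g y' - g y| ^ (r : ℝ) := by
    intro y hy y' hy' hlt
    have hfl : ∀ n, (idx n y : ℝ) ≤ y * (A n).M ∧ y' * (A n).M < idx n y' + 1 ∧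
        idx n y ≤ idx n y' := fun n =>
      ⟨Nat.floor_le (mul_nonneg hy.1 (by positivity)), Nat.lt_floor_add_one _, by
        simp only [idx]; gcongr⟩
    -- the two points lie in different intervals from some stage on
    have hne : ∃ n, idx n y ≠ idx n y' := by
      by_contra! heq
      obtain ⟨n, hn⟩ := pow_unbounded_of_one_lt (1 / (y' - y)) one_lt_two
      have h0 : 0 < y' - y := sub_pos.2 hlt
      obtain ⟨h1, h2, -⟩ := hfl n
      rw [heq n] at h1
      have h3 : (2 : ℝ) ^ n ≤ (A n).M := by exact_mod_cast hMpow n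
      rw [div_lt_iff₀ h0] at hn
      nlinarith
    obtain ⟨n, hn, hn'⟩ : ∃ n, idx n y = idx n y' ∧ idx (n + 1) y ≠ idx (n + 1) y' := by
      classical
      by_contra! hcon
      obtain ⟨n, hn⟩ := hne
      refine hn ?_
      clear hn
      induction n with
      | zero =>
        have h1 : ∀ z ∈ Ico (0 : ℝ) 1, idx 0 z = 0 := fun z hz => by
          have : (A 0).M = 1 := rfl
          simp only [idx, this]
          rw [Nat.floor_eq_zero]
          simpa using hz.2
        rw [h1 y hy, h1 y' hy']
      | succ n ih => exact hcon n ih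
    set a : ℝ := ((A n).M : ℝ) with ha
    have ha0 : 0 < a := by rw [ha]; exact_mod_cast (A n).M_pos
    set l := (A n).l with hl
    have hl0 : 0 < l := (A n).l_pos
    set M : ℝ := (m (A n) n : ℝ) with hMdef
    have hM0 : 0 < M := by
      have := hm2 (A n) n
      rw [hMdef]
      positivity
    have hAM : ((A (n + 1)).M : ℝ) = a * M := by rw [hA, hM]; push_cast; rfl
    have h1 : y' - y ≤ 1 / a := by
      obtain ⟨h1, h2, -⟩ := hfl n
      rw [hn] at h1
      rw [le_div_iff₀ ha0]
      linarith
    obtain ⟨h2, h3, h4⟩ := hfl (n + 1)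
    have hij : idx (n + 1) y < idx (n + 1) y' := lt_of_le_of_ne h4 hn'
    set j : ℝ := (idx (n + 1) y' : ℝ) - idx (n + 1) y with hj
    have hj1 : 1 ≤ j := by
      have : (idx (n + 1) y : ℝ) + 1 ≤ idx (n + 1) y' := by exact_mod_cast hij
      rw [hj]; linarith
    have h5 : y' - y ≤ 1 / a * (2 * j / M) := by
      rw [div_mul_div_comm, one_mul, le_div_iff₀ (by positivity), ← hAM]
      linarith
    have hlast : idx (n + 1) y' < (A (n + 1)).M := by
      simp only [idx]
      rw [Nat.floor_lt (mul_nonneg hy'.1 (by positivity))]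
      have : (0 : ℝ) < (A (n + 1)).M := by exact_mod_cast (A (n + 1)).M_pos
      nlinarith [hy'.2]
    have h6 : j * (l / (512 * M)) ≤ g y' - g y := by
      have h := hgap (A n) n _ _ hij hlast
      have := (hg y (n + 1)).2
      have := (hg y' (n + 1)).1
      rw [hA] at *
      linarith
    have h7 : y' - y ≤ 1 / a * (2 * j / M) ^ (r : ℝ) := by
      rcases le_total (2 * j / M) 1 with hu | hu
      · refine h5.trans ?_
        gcongr
        exact Real.self_le_rpow_of_le_one (by positivity) hu hr1
      · refine h1.trans (le_mul_of_one_le_right (by positivity) ?_)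
        exact Real.one_le_rpow hu hr0'.le
    have hmass : 1 / a ≤ l ^ (r : ℝ) := by
      rw [div_le_iff₀' ha0]
      exact (A n).mass
    calc y' - y ≤ l ^ (r : ℝ) * (2 * j / M) ^ (r : ℝ) := h7.trans (by gcongr)
      _ = 1024 ^ (r : ℝ) * (j * (l / (512 * M))) ^ (r : ℝ) := by
        rw [← Real.mul_rpow (by positivity) (by positivity),
          ← Real.mul_rpow (by positivity) (by positivity)]
        congr 1
        field_simp
        ring
      _ ≤ 1024 ^ (r : ℝ) * |g y' - g y| ^ (r : ℝ) := by
        gcongr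
        exact h6.trans (le_abs_self _)
      _ = _ := by push_cast; rfl
  have hdim : dimH (Ico (0 : ℝ) 1) = 1 := by
    rw [Real.dimH_of_nonempty_interior]
    · simp
    · rw [interior_Ico]; exact ⟨1 / 2, by norm_num, by norm_num⟩
  have := mul_dimH_le_dimH_image hr0 hholder
  rw [hdim, mul_one] at this
  exact this.trans (dimH_mono hgH1)

/-- The **Jarník–Besicovitch theorem**, for exponents `μ > 1`. -/
theorem dimH_H1 {μ : ℝ} (hμ : 1 < μ) : dimH (H1 μ) = ENNReal.ofReal (2 / (1 + μ)) := by
  refine le_antisymm (dimH_H1_le (by linarith)) (ENNReal.le_of_forall_nnreal_lt fun r hr => ?_)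
  rcases eq_or_lt_of_le (zero_le (a := r)) with rfl | hr0
  · simp
  · rw [ENNReal.lt_ofReal_iff_toReal_lt ENNReal.coe_ne_top, ENNReal.coe_toReal,
      lt_div_iff₀ (by linarith)] at hr
    exact le_dimH_H1 hμ hr0 hr

/-! ### Points of the curve -/

lemma dimH_curve_inter {k : ℕ} (hk : 0 < k) (P : Fin k → ℚ[X]) (hP1 : P ⟨0, hk⟩ = X)
    (S : Set (EuclideanSpace ℝ (Fin k))) :
    dimH (curve P ∩ S) = dimH ((fun x : EuclideanSpace ℝ (Fin k) => x ⟨0, hk⟩) '' (curve P ∩ S)) := by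
  refine le_antisymm ?_ ?_
  · set γ : ℝ → EuclideanSpace ℝ (Fin k) := fun t => WithLp.toLp 2 fun j => aeval t (P j) with hγ
    have hsub : curve P ∩ S ⊆
        γ '' ((fun x : EuclideanSpace ℝ (Fin k) => x ⟨0, hk⟩) '' (curve P ∩ S)) := by
      rintro _ ⟨⟨t, rfl⟩, hS⟩
      refine ⟨t, ⟨_, ⟨⟨t, rfl⟩, hS⟩, ?_⟩, rfl⟩
      simp [hP1]
    have hcd : ContDiff ℝ 1 γ := by
      rw [contDiff_euclidean]
      exact fun j => Polynomial.contDiff_aeval (P j) 1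
    exact (dimH_mono hsub).trans
      (hcd.contDiffOn.dimH_image_le convex_univ (subset_univ _))
  · have hlip : LipschitzWith 1 fun x : EuclideanSpace ℝ (Fin k) => x ⟨0, hk⟩ :=
      LipschitzWith.of_dist_le_mul fun x y => by
        rw [NNReal.coe_one, one_mul, dist_eq_norm, dist_eq_norm]
        exact PiLp.norm_apply_le (x - y) ⟨0, hk⟩
    exact hlip.dimH_image_le _

end CurveApprox

theorem theorem2p5 (k : ℕ) (hk : 0 < k) (P : Fin k → ℚ[X])
    (hP1 : P ⟨0, hk⟩ = X)
    (hdeg : Monotone fun j : Fin k => (P j).natDegree)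
    (hnd : CurveApprox.NonDegenerate P)
    (d : ℕ) (hd : d = (P ⟨k - 1, Nat.sub_lt hk one_pos⟩).natDegree)
    (lam : ℝ) (hlam : (d : ℝ) - (k : ℝ) + 1 < lam) :
    (fun x : EuclideanSpace ℝ (Fin k) => x ⟨0, hk⟩) ''
        (CurveApprox.curve P ∩ CurveApprox.H k lam)
        = CurveApprox.H1 ((d : ℝ) * lam + (d : ℝ) - 1) ∧
    CurveApprox.H1 ((d : ℝ) * lam + (d : ℝ) - 1)
        = {ζ : ℝ | (((d : ℝ) * lam + (d : ℝ) - 1 : ℝ) : EReal) ≤ CurveApprox.lambda1 ζ} ∧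
    dimH (CurveApprox.curve P ∩ CurveApprox.H k lam)
        = ENNReal.ofReal (2 / ((d : ℝ) * (lam + 1))) := by
  have hdeg' : ∀ j, (P j).natDegree ≤ d := fun j => by
    rw [hd]
    exact hdeg (show j.1 ≤ k - 1 by omega)
  have hkd : k ≤ d := CurveApprox.le_of_nonDegenerate hnd hdeg'
  have hkd' : (k : ℝ) ≤ d := by exact_mod_cast hkd
  have hd1 : (1 : ℝ) ≤ d := by exact_mod_cast hk.trans_le hkd
  have hlam1 : 1 < lam := by linarith
  have himg : (fun x : EuclideanSpace ℝ (Fin k) => x ⟨0, hk⟩) ''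
      (CurveApprox.curve P ∩ CurveApprox.H k lam)
      = CurveApprox.H1 ((d : ℝ) * lam + (d : ℝ) - 1) := by
    ext t
    constructor
    · rintro ⟨_, ⟨⟨t, rfl⟩, hH⟩, rfl⟩
      have ht := CurveApprox.mem_H1_of_mem_H hk P hP1 hnd hdeg' (hk.trans_le hkd) ⟨_, hd.symm⟩ hlam
        (by linarith) hH
      simpa [hP1] using ht
    · intro ht
      refine ⟨_, ⟨⟨t, rfl⟩, CurveApprox.mem_H_of_mem_H1 P (hk.trans_le hkd) hdeg' (by linarith) ht⟩,
        ?_⟩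
      simp [hP1]
  refine ⟨himg, CurveApprox.H1_eq_setOf_le_lambda1 _, ?_⟩
  rw [CurveApprox.dimH_curve_inter hk P hP1, himg, CurveApprox.dimH_H1 (by nlinarith)]
  congr 2
  ring
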